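/- Let $k\ge 1$, $n_1,\dots,n_k\ge 1$, and let $a^i\in\mathbb{R}_{\ge 0}^{n_i}$, $b_i\in\mathbb{R}_{\ge 0}$ be such that the separable subset-sum set $\{(x^1,\dots,x^k)\in\{0,1\}^{n_1+\dots+n_k} : a^i x^i=b_i \text{ for all } i\}$ is non-empty. Let $P=\{(x^1,\dots,x^k)\in[0,1]^{n_1+\dots+n_k} : a^ix^i\le b_i,\ -a^ix^i\le -b_i \text{ for all } i\}$ be its LP relaxation; write its inequalities (other than the bounds $0\le x\le 1$) as $Ax\le b$. The algorithm WFP with parameter $\ell$ starts from an optimal solution $\bar x^0$ of the LP relaxation (with any linear objective) and $\tilde x^0=\mathrm{round}(\bar x^0)$, where $\mathrm{round}$ rounds each coordinate to the nearest integer and $\tfrac12$ to $1$. In iteration $t=1,2,\dots$ it computes a point $\bar x^t=\ell_1\text{-}\mathrm{proj}(P,\tilde x^{t-1})$ of $P$ at minimal $\ell_1$-distance from $\tilde x^{t-1}$, sets $\tilde x^t=\mathrm{round}(\bar x^t)$, and returns $\tilde x^t$ if $\tilde x^t\in P$. Otherwise, if $\tilde x^t=\tilde x^{t-1}$, it applies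 the following randomization step to $\tilde x^t$. Take a minimal certificate for $\tilde x^t$, that is, an inequality $\lambda Ax\le\lambda b$ with $\lambda\ge 0$ that $\tilde x^t$ violates, with the support of $\lambda$ inclusion-minimal among all such $\lambda$. Then sample $\ell$ indices uniformly and independently (with repetition allowed) from the support of $\lambda A$, and flip the value of every coordinate of $\tilde x^t$ whose index belongs to the set of indices obtained. The projection and the certificate are chosen by arbitrary fixed rules with these properties (functions of the current 0/1 point), except that $\ell_1\text{-}\mathrm{proj}(P,\tilde x)$ is assumed to be a vertex of $P$ whenever $\tilde x\notin P$. Then for every $\delta\in(0,1]$, with probability at least $1-\delta$, WFP with $\ell=2$ returns a feasible solution within $$T=\lceil\ln(k/\delta)\rceil\,\sum_{i=1}^k n_i\,2^{2n_i\log_2 n_i}$$ iterations, and $T\le \bar n\,k\,2^{2\bar n\log_2\bar n}\,\lceil\ln(k/\delta)\rceil$, where $\bar n=\max_i n_i$. -/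

import Mathlib

open Matrix

namespace FeasibilityPump

/-- The LP relaxation `{x ∈ [0,1]^ι : A x ≤ b}` of a pure-binary linear system. -/
def relaxation {ι κ : Type*} [Fintype ι] (A : Matrix κ ι ℝ) (b : κ → ℝ) : Set (ι → ℝ) :=
  {x | (∀ i, x i ∈ Set.Icc (0 : ℝ) 1) ∧ A *ᵥ x ≤ b}

/-- A 0/1 point, read as a real vector. -/
def toVec {ι : Type*} (z : ι → Bool) : ι → ℝ := fun i => if z i then 1 else 0

/-- Coordinatewise rounding of a vector of `[0,1]^ι` to the closest 0/1 point; `1/2` is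
rounded to `1`. -/
noncomputable def roundVec {ι : Type*} (v : ι → ℝ) : ι → Bool := fun i => decide (1 / 2 ≤ v i)

/-- `x` is an `ℓ₁`-projection of the 0/1 point `z` onto `P`: a point of `P` at minimal
`ℓ₁`-distance from `z`. -/
def IsL1Proj {ι : Type*} [Fintype ι] (P : Set (ι → ℝ)) (z : ι → Bool) (x : ι → ℝ) : Prop :=
  x ∈ P ∧ ∀ x' ∈ P, ∑ i, |toVec z i - x i| ≤ ∑ i, |toVec z i - x' i|

/-- `lam ≥ 0` is a certificate of infeasibility for the 0/1 point `z`: the combined inequality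
`(lam A) x ≤ lam b` is violated by `z`. -/
def IsCertificate {ι κ : Type*} [Fintype ι] [Fintype κ] (A : Matrix κ ι ℝ) (b : κ → ℝ)
    (z : ι → Bool) (lam : κ → ℝ) : Prop :=
  (∀ r, 0 ≤ lam r) ∧ lam ⬝ᵥ b < (lam ᵥ* A) ⬝ᵥ toVec z

/-- A certificate using an inclusion-minimal set of the original inequalities. -/
def IsMinimalCertificate {ι κ : Type*} [Fintype ι] [Fintype κ] (A : Matrix κ ι ℝ) (b : κ → ℝ)
    (z : ι → Bool) (lam : κ → ℝ) : Prop :=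
  IsCertificate A b z lam ∧
    ∀ mu : κ → ℝ, IsCertificate A b z mu →
      Function.support mu ⊆ Function.support lam → Function.support mu = Function.support lam

/-- The set of variables that occur in the combined inequality `(lam A) x ≤ lam b`. -/
noncomputable def certSupport {ι κ : Type*} [Fintype ι] [Fintype κ] (A : Matrix κ ι ℝ)
    (lam : κ → ℝ) : Finset ι :=
  Finset.univ.filter fun i => (lam ᵥ* A) i ≠ 0

/-- Flip the coordinates of `z` that belong to `I`. -/
def flip {ι : Type*} [DecidableEq ι] (z : ι → Bool) (I : Finset ι) : ι → Bool :=
  fun i => if i ∈ I then !(z i) else z i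

/-- The WalkSAT-type randomization step: sample `ℓ` indices uniformly and independently from the
support of the certificate (that is, a uniform `ℓ`-tuple of elements of the support), and flip
the coordinates in the set of indices obtained. The `else` branch only makes the function total:
for a feasible system the support of a certificate is never empty. -/
noncomputable def perturb {ι κ : Type*} [Fintype ι] [DecidableEq ι] [Fintype κ]
    (A : Matrix κ ι ℝ) (ℓ : ℕ) (lam : κ → ℝ) (z : ι → Bool) : PMF (ι → Bool) :=
  if h : (certSupport A lam).Nonempty then
    (PMF.uniformOfFinset (Fintype.piFinset fun _ : Fin ℓ => certSupport A lam)
      (Fintype.piFinset_nonempty.2 fun _ => h)).map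
        fun f => flip z (Finset.univ.image f)
  else PMF.pure z

/-- The status of a run: still running, with current 0/1 point `z`, or stopped, having returned
the 0/1 point `z`. -/
inductive State (ι : Type*) where
  | running (z : ι → Bool) : State ι
  | returned (z : ι → Bool) : State ι

open Classical in
/-- One iteration of WFP for the system `A x ≤ b`, where `proj` is the `ℓ₁`-projection used and
`cert` is the rule which chooses the infeasibility certificates: project, round, return if the
point is feasible, and apply the randomization step if the point equals the previous one. -/
noncomputable def step {ι κ : Type*} [Fintype ι] [DecidableEq ι] [Fintype κ]
    (A : Matrix κ ι ℝ) (b : κ → ℝ) (ℓ : ℕ)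
    (proj : (ι → Bool) → (ι → ℝ)) (cert : (ι → Bool) → (κ → ℝ)) :
    State ι → PMF (State ι)
  | .returned z => PMF.pure (.returned z)
  | .running z =>
    let z' := roundVec (proj z)
    if toVec z' ∈ relaxation A b then PMF.pure (.returned z')
    else if z' = z then (perturb A ℓ (cert z') z').map .running
    else PMF.pure (.running z')

/-- The law of the status of WFP after `t` iterations, when started from the LP solution `x₀`. -/
noncomputable def wfp {ι κ : Type*} [Fintype ι] [DecidableEq ι] [Fintype κ]
    (A : Matrix κ ι ℝ) (b : κ → ℝ) (ℓ : ℕ)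
    (proj : (ι → Bool) → (ι → ℝ)) (cert : (ι → Bool) → (κ → ℝ)) (x₀ : ι → ℝ) :
    ℕ → PMF (State ι)
  | 0 => PMF.pure (.running (roundVec x₀))
  | t + 1 => (wfp A b ℓ proj cert x₀ t).bind (step A b ℓ proj cert)

/-- The separable subset-sum set `{(x¹,…,xᵏ) ∈ {0,1}^(n₁+…+nₖ) : aⁱ xⁱ = bᵢ for all i}`. -/
def subsetSumSet {k : ℕ} {n : Fin k → ℕ} (a : (i : Fin k) → Fin (n i) → ℝ) (b : Fin k → ℝ) :
    Set ((Σ i : Fin k, Fin (n i)) → Bool) :=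
  {z | ∀ i, ∑ j, a i j * toVec z ⟨i, j⟩ = b i}

/-- The equations `aⁱ xⁱ = bᵢ` as inequalities: row `(i, true)` is `aⁱ xⁱ ≤ bᵢ` and row
`(i, false)` is `-aⁱ xⁱ ≤ -bᵢ`. This is the matrix of left-hand sides. -/
def subsetSumMatrix {k : ℕ} {n : Fin k → ℕ} (a : (i : Fin k) → Fin (n i) → ℝ) :
    Matrix (Fin k × Bool) (Σ i : Fin k, Fin (n i)) ℝ :=
  fun r v => if v.1 = r.1 then (if r.2 then a v.1 v.2 else -a v.1 v.2) else 0

/-- The right-hand sides of the inequalities with matrix `subsetSumMatrix a`. -/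
def subsetSumRhs {k : ℕ} (b : Fin k → ℝ) : Fin k × Bool → ℝ :=
  fun r => if r.2 then b r.1 else -b r.1

end FeasibilityPump

/-!
The equations `aⁱ xⁱ = bᵢ` share no variables, so the projection acts block by block, and the proof
follows the potential of a single block, with a fixed solution `x` as reference point.

Call a 0/1 point *stable* in a block (`Stable`) if moving one coordinate by less than `1/2` (by at
most `1/2` when lowering it) repairs the equation. Projecting and rounding makes every block stable,
because a vertex has at most one relevant fractional coordinate per block
(`stable_roundVec_of_mem_extremePoints`), and it leaves stable blocks unchanged, because the
projection is then at distance at most `1/2` (`IsL1Proj.block_roundVec`). So the algorithm gets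
stuck exactly at points whose blocks are all stable, and between two randomization steps there is
at most one other iteration. A minimal certificate is a single violated row
(`IsMinimalCertificate.exists_certSupport_eq`), so a randomization step perturbs one violated block
and leaves the others stable.

In a stable violated block with `N` variables, of which `d` with nonzero coefficients differ from
those of `x`, some pair of indices leads to a stable point closer to `x`, and to a solution if
`d ≤ 2` (`exists_potential_flip_le`). It is drawn with probability at least `p = 1 / N ^ 2`. Hence
at most `N - 1` consecutive good draws solve
the block. This is turned into a supermartingale: the potential `1 + p + ⋯ + p ^ (r - 1)` of a point
from which `r` good draws suffice contracts on average by the factor `1 - p ^ (N - 1) (1 - p)` in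
each randomization step of the block (`sum_le_card_mul_contraction`). As the certificates decide
which block is perturbed, every block gets its own budget of randomization steps. By induction on
the number of iterations, the sum over the blocks of the potentials, each discounted by the
contraction factor to the power of the budget, bounds the probability of failure
(`iterExpect_le_totalPotential`). The budget `3 L N ^ (2 (N - 1))` with `L = ⌈ln (k / δ)⌉` makes the
contribution of each block at most `exp (-L) ≤ δ / k`, and two iterations per budgeted step fit into
`T`.
-/

namespace FeasibilityPump

/-! ### Stable points of a single equation -/

section Block

variable {α : Type*} [Fintype α]

/-- The signed amount `b - a y` by which the 0/1 point `y` misses the equation `a y = b`. -/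
noncomputable def gap (a : α → ℝ) (b : ℝ) (y : α → Bool) : ℝ := b - ∑ j, a j * toVec y j

/-- A 0/1 point is stable for `a y = b` if the equation can be repaired by moving a single
coordinate by an amount that rounding undoes. The asymmetry between the two inequalities comes
from rounding `1/2` up. -/
def Stable (a : α → ℝ) (b : ℝ) (y : α → Bool) : Prop :=
  (0 < gap a b y → ∃ m, y m = false ∧ 2 * gap a b y < a m) ∧
    (gap a b y < 0 → ∃ m, y m = true ∧ -(2 * gap a b y) ≤ a m)

/-- The coordinates that occur in the equation and at which `y` differs from `x`. -/
noncomputable def mismatch (a : α → ℝ) (x y : α → Bool) : Finset α :=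
  Finset.univ.filter fun j => a j ≠ 0 ∧ y j ≠ x j

theorem mem_mismatch {a : α → ℝ} {x y : α → Bool} {j : α} :
    j ∈ mismatch a x y ↔ a j ≠ 0 ∧ y j ≠ x j := by
  simp [mismatch]

theorem gap_eq_sum_mismatch {a : α → ℝ} {b : ℝ} {x : α → Bool} (hx : gap a b x = 0)
    (y : α → Bool) :
    gap a b y = ∑ j ∈ mismatch a x y, (if y j then -a j else a j) := by
  have hb : b = ∑ j, a j * toVec x j := by unfold gap at hx; linarith
  rw [gap, hb, ← Finset.sum_sub_distrib, mismatch, Finset.sum_filter]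
  refine Finset.sum_congr rfl fun j _ => ?_
  by_cases h : a j = 0
  · simp [h]
  · cases hy : y j <;> cases hx' : x j <;> simp [toVec, hy, hx', h]

theorem gap_eq_zero_of_mismatch_eq_empty {a : α → ℝ} {b : ℝ} {x y : α → Bool}
    (hx : gap a b x = 0) (h : mismatch a x y = ∅) : gap a b y = 0 := by
  simp [gap_eq_sum_mismatch hx, h]

variable [DecidableEq α]

theorem gap_flip (a : α → ℝ) (b : ℝ) (y : α → Bool) (I : Finset α) :
    gap a b (flip y I) = gap a b y + ∑ j ∈ I, (if y j then a j else -a j) := by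
  have : ∑ j ∈ I, (if y j then a j else -a j)
      = ∑ j, if j ∈ I then (if y j then a j else -a j) else 0 := by simp
  rw [this, gap, gap, sub_add, ← Finset.sum_sub_distrib]
  congr 1
  refine Finset.sum_congr rfl fun j _ => ?_
  by_cases h : j ∈ I <;> cases hy : y j <;> simp [toVec, flip, h, hy]

theorem mismatch_flip (a : α → ℝ) (x y : α → Bool) {I : Finset α} (hI : I ⊆ mismatch a x y) :
    mismatch a x (flip y I) = mismatch a x y \ I := by
  ext j
  have := @hI j
  rw [mem_mismatch] at this
  simp only [mem_mismatch, Finset.mem_sdiff, flip]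
  by_cases h : j ∈ I
  · have := (this h).2
    cases hy : y j <;> cases hx : x j <;> simp_all
  · simp [h]

/-- From a stable point whose left-hand side is too small, flipping one or two mismatched
coordinates leads to a stable point again. For `j` to be raised and `l` to be lowered, flipping
`j` is stable if `a l` is large compared with the overshoot, flipping `l` is stable if `a j` is
large compared with the new gap, and flipping both is stable in the remaining case. -/
theorem exists_stable_flip_of_gap_pos {a : α → ℝ} {b : ℝ} {x y : α → Bool} (ha : ∀ j, 0 ≤ a j)
    (hx : gap a b x = 0) (hy : Stable a b y) (hpos : 0 < gap a b y) :
    ∃ j ∈ mismatch a x y, ∃ l ∈ mismatch a x y, Stable a b (flip y {j, l}) := by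
  obtain ⟨m, hm, hgm⟩ := hy.1 hpos
  have hsum := gap_eq_sum_mismatch hx y
  set g := gap a b y with hg
  -- a missing coordinate exists, since the true solution has a larger left-hand side
  obtain ⟨j, hj, hj0⟩ : ∃ j ∈ mismatch a x y, y j = false := by
    by_contra! hcon
    have : g ≤ 0 := by
      rw [hsum]
      refine Finset.sum_nonpos fun j hj => ?_
      have := hcon j hj
      simp at this
      simp [this, ha j]
    linarith
  have gj : gap a b (flip y {j, j}) = g - a j := by
    rw [gap_flip]; simp [hj0]; ring
  have hjj : flip y {j, j} j = true := by simp [flip, hj0]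
  by_cases hjg : a j ≤ g
  · refine ⟨j, hj, j, hj, fun _ => ⟨m, ?_, by rw [gj]; linarith [ha j]⟩,
      fun h => absurd h (by rw [gj]; linarith)⟩
    have : m ≠ j := by rintro rfl; linarith
    simp [flip, this, hm]
  push Not at hjg
  obtain ⟨l, hl, hl1⟩ : ∃ l ∈ mismatch a x y, y l = true := by
    by_contra! hcon
    have : a j ≤ g := by
      rw [hsum]
      have hle := Finset.single_le_sum (f := fun j => if y j then -a j else a j) (fun i hi => by
        have := hcon i hi
        simp at this
        simp [this, ha i]) hj
      simpa [hj0] using hle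
    linarith
  have hne : j ≠ l := by rintro rfl; simp_all
  have gl : gap a b (flip y {l, l}) = g + a l := by
    rw [gap_flip]; simp [hl1]; linarith
  have gjl : gap a b (flip y {j, l}) = g - a j + a l := by
    rw [gap_flip, Finset.sum_pair hne]; simp [hl1, hj0]; ring
  by_cases h1 : 2 * (a j - g) ≤ a l
  · exact ⟨j, hj, j, hj, fun h => absurd h (by rw [gj]; linarith),
      fun _ => ⟨l, by simp [flip, hne.symm, hl1], by rw [gj]; linarith⟩⟩
  by_cases h2 : 2 * (g + a l) < a j
  · exact ⟨l, hl, l, hl, fun _ => ⟨j, by simp [flip, hne, hj0], by rw [gl]; linarith⟩,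
      fun h => absurd h (by rw [gl]; linarith [ha l])⟩
  push Not at h1 h2
  exact ⟨j, hj, l, hl, fun _ => ⟨l, by simp [flip, hl1], by rw [gjl]; linarith⟩,
    fun _ => ⟨j, by simp [flip, hj0], by rw [gjl]; linarith⟩⟩

/-- The overshooting counterpart of `exists_stable_flip_of_gap_pos`. -/
theorem exists_stable_flip_of_gap_neg {a : α → ℝ} {b : ℝ} {x y : α → Bool} (ha : ∀ j, 0 ≤ a j)
    (hx : gap a b x = 0) (hy : Stable a b y) (hneg : gap a b y < 0) :
    ∃ j ∈ mismatch a x y, ∃ l ∈ mismatch a x y, Stable a b (flip y {j, l}) := by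
  obtain ⟨m, hm, hgm⟩ := hy.2 hneg
  have hsum := gap_eq_sum_mismatch hx y
  set g := gap a b y with hg
  obtain ⟨l, hl, hl1⟩ : ∃ l ∈ mismatch a x y, y l = true := by
    by_contra! hcon
    have : 0 ≤ g := by
      rw [hsum]
      refine Finset.sum_nonneg fun j hj => ?_
      have := hcon j hj
      simp at this
      simp [this, ha j]
    linarith
  have gl : gap a b (flip y {l, l}) = g + a l := by
    rw [gap_flip]; simp [hl1]; linarith
  by_cases hlg : a l ≤ -g
  · refine ⟨l, hl, l, hl, fun h => absurd h (by rw [gl]; linarith),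
      fun _ => ⟨m, ?_, by rw [gl]; linarith [ha l]⟩⟩
    have : m ≠ l := by rintro rfl; linarith
    simp [flip, this, hm]
  push Not at hlg
  obtain ⟨j, hj, hj0⟩ : ∃ j ∈ mismatch a x y, y j = false := by
    by_contra! hcon
    have : g ≤ -a l := by
      rw [hsum]
      have hle := Finset.single_le_sum (f := fun j => -(if y j then -a j else a j))
        (fun i hi => by
          have := hcon i hi
          simp at this
          simp [this, ha i]) hl
      rw [Finset.sum_neg_distrib] at hle
      simp only [hl1, if_true] at hle
      linarith
    linarith
  have hne : j ≠ l := by rintro rfl; simp_all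
  have gj : gap a b (flip y {j, j}) = g - a j := by
    rw [gap_flip]; simp [hj0]; ring
  have gjl : gap a b (flip y {j, l}) = g - a j + a l := by
    rw [gap_flip, Finset.sum_pair hne]; simp [hl1, hj0]; ring
  by_cases h1 : 2 * (a l + g) < a j
  · exact ⟨l, hl, l, hl, fun _ => ⟨j, by simp [flip, hne, hj0], by rw [gl]; linarith⟩,
      fun h => absurd h (by rw [gl]; linarith)⟩
  by_cases h2 : 2 * (a j - g) ≤ a l
  · exact ⟨j, hj, j, hj, fun h => absurd h (by rw [gj]; linarith [ha j]),
      fun _ => ⟨l, by simp [flip, hne.symm, hl1], by rw [gj]; linarith⟩⟩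
  push Not at h1 h2
  exact ⟨j, hj, l, hl, fun _ => ⟨l, by simp [flip, hl1], by rw [gjl]; linarith⟩,
    fun _ => ⟨j, by simp [flip, hj0], by rw [gjl]; linarith⟩⟩

end Block

/-! ### The potential of a block -/

section Potential

/-- The geometric sum `1 + p + ⋯ + p ^ (r - 1)`. -/
noncomputable def geo (p : ℝ) (r : ℕ) : ℝ := ∑ q ∈ Finset.range r, p ^ q

theorem geo_mono {p : ℝ} (hp : 0 ≤ p) : Monotone (geo p) := fun _ _ h =>
  Finset.sum_le_sum_of_subset_of_nonneg (Finset.range_mono h) fun _ _ _ => pow_nonneg hp _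

theorem geo_nonneg {p : ℝ} (hp : 0 ≤ p) (r : ℕ) : 0 ≤ geo p r :=
  Finset.sum_nonneg fun _ _ => pow_nonneg hp _

theorem one_le_geo {p : ℝ} (hp : 0 ≤ p) {r : ℕ} (hr : 1 ≤ r) : 1 ≤ geo p r := by
  simpa [geo] using geo_mono hp hr

theorem geo_mul (p : ℝ) (r : ℕ) : geo p r * (1 - p) = 1 - p ^ r := geom_sum_mul_neg p r

/-- The factor by which the potential of a block of size `N` contracts, in expectation, in each
randomization step: `1 - p ^ (N - 1) (1 - p)`, where `p = 1 / N ^ 2` is a lower bound for the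
probability of one given pair of indices. -/
noncomputable def contraction (N : ℕ) : ℝ :=
  1 - (1 / (N : ℝ) ^ 2) ^ (N - 1) * (1 - 1 / (N : ℝ) ^ 2)

theorem one_div_sq_mem {N : ℕ} (hN : 0 < N) :
    0 < 1 / (N : ℝ) ^ 2 ∧ 1 / (N : ℝ) ^ 2 ≤ 1 := by
  have h1 : (1 : ℝ) ≤ N := by exact_mod_cast hN
  have h2 : (1 : ℝ) ≤ (N : ℝ) ^ 2 := one_le_pow₀ h1
  exact ⟨by positivity, by rw [div_le_one (by positivity)]; exact h2⟩

theorem contraction_nonneg {N : ℕ} (hN : 0 < N) : 0 ≤ contraction N := by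
  obtain ⟨h0, h1⟩ := one_div_sq_mem hN
  have := pow_le_one₀ (n := N - 1) h0.le h1
  have := pow_nonneg h0.le (N - 1)
  unfold contraction
  nlinarith

/-- If one outcome out of at most `N ^ 2` equally likely ones lowers the level, and all others at
worst raise it to its maximum `N - 1`, then the geometric potential contracts on average. -/
theorem sum_le_card_mul_contraction {τ : Type*} {t : Finset τ} {F : τ → ℝ} {N r : ℕ} (hN : 0 < N)
    (hr : 1 ≤ r) (hrN : r ≤ N - 1) (ht : t.card ≤ N ^ 2)
    (hF : ∀ f ∈ t, F f ≤ geo (1 / (N : ℝ) ^ 2) (N - 1))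
    {f₀ : τ} (hf₀ : f₀ ∈ t) (hFf₀ : F f₀ ≤ geo (1 / (N : ℝ) ^ 2) (r - 1)) :
    ∑ f ∈ t, F f ≤ t.card * (contraction N * geo (1 / (N : ℝ) ^ 2) r) := by
  classical
  obtain ⟨h0, h1⟩ := one_div_sq_mem hN
  have hNN : (0 : ℝ) < (N : ℝ) ^ 2 := by positivity
  unfold contraction
  have hpN : 1 / (N : ℝ) ^ 2 * (N : ℝ) ^ 2 = 1 := by field_simp
  set p := 1 / (N : ℝ) ^ 2
  have hs : ∑ f ∈ t, F f ≤ (t.card - 1) * geo p (N - 1) + geo p (r - 1) := by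
    rw [← Finset.sum_erase_add _ _ hf₀]
    refine add_le_add ?_ hFf₀
    have := Finset.sum_le_card_nsmul (t.erase f₀) F (geo p (N - 1))
      fun f hf => hF f (Finset.mem_of_mem_erase hf)
    rw [Finset.card_erase_of_mem hf₀, nsmul_eq_mul,
      Nat.cast_sub (Finset.card_pos.2 ⟨f₀, hf₀⟩), Nat.cast_one] at this
    exact this
  have hc : (t.card : ℝ) * p ≤ 1 := by
    have : (t.card : ℝ) ≤ (N : ℝ) ^ 2 := by exact_mod_cast ht
    nlinarith
  have hB : geo p (r - 1) ≤ geo p (N - 1) := geo_mono h0.le (by omega)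
  have hrec : geo p r = 1 + p * geo p (r - 1) := by
    obtain ⟨q, rfl⟩ : ∃ q, r = q + 1 := ⟨r - 1, by omega⟩
    simp only [geo, Nat.add_sub_cancel]
    rw [Finset.sum_range_succ', Finset.mul_sum]
    simp [pow_succ', add_comm]
  have hm := geo_mul p (N - 1)
  have hgr := geo_mul p r
  have hpr : 0 ≤ p ^ r := pow_nonneg h0.le _
  have hpm : 0 ≤ p ^ (N - 1) := pow_nonneg h0.le _
  -- the average is at most `(1 - p) B + p B₀`, where `B`, `B₀` are the two bounds
  have key : (1 - p) * geo p (N - 1) + p * geo p (r - 1)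
      ≤ (1 - p ^ (N - 1) * (1 - p)) * geo p r := by
    have : (1 - p ^ (N - 1) * (1 - p)) * geo p r = geo p r - p ^ (N - 1) * (1 - p ^ r) := by
      rw [← hgr]; ring
    rw [this, hrec]
    nlinarith [mul_nonneg hpm hpr]
  have hcard : (0 : ℝ) ≤ t.card := by positivity
  calc ∑ f ∈ t, F f ≤ (t.card - 1) * geo p (N - 1) + geo p (r - 1) := hs
    _ ≤ t.card * ((1 - p) * geo p (N - 1) + p * geo p (r - 1)) := by nlinarith
    _ ≤ _ := mul_le_mul_of_nonneg_left key hcard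

variable {α : Type*} [Fintype α]

/-- The level of a stable infeasible point: how many good randomization steps suffice to reach a
solution. It is `d - 1` for a point at distance `d ≥ 2` from the solution `x`, since the last two
mismatches can be repaired in one step. -/
noncomputable def level (a : α → ℝ) (x y : α → Bool) : ℕ := max 1 ((mismatch a x y).card - 1)

open Classical in
/-- The potential of a block at the 0/1 point `y`: zero at solutions, the geometric sum of the
level at other stable points, and the largest possible value at points which are not stable. -/
noncomputable def potential (a : α → ℝ) (b : ℝ) (x y : α → Bool) : ℝ :=
  if gap a b y = 0 then 0
  else if Stable a b y then geo (1 / (Fintype.card α : ℝ) ^ 2) (level a x y)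
  else geo (1 / (Fintype.card α : ℝ) ^ 2) (Fintype.card α - 1)

theorem Stable.of_gap_eq_zero {a : α → ℝ} {b : ℝ} {y : α → Bool} (h : gap a b y = 0) :
    Stable a b y := ⟨fun h' => absurd h h'.ne', fun h' => absurd h h'.ne⟩

theorem Stable.one_lt_card {a : α → ℝ} {b : ℝ} {x y : α → Bool} (ha : ∀ j, 0 ≤ a j)
    (hx : gap a b x = 0) (hy : Stable a b y) (h : gap a b y ≠ 0) : 1 < Fintype.card α := by
  by_contra! hcard
  have := Fintype.card_le_one_iff_subsingleton.1 hcard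
  unfold Stable gap toVec at *
  rcases lt_or_gt_of_ne h with h' | h'
  · obtain ⟨m, hm, hgm⟩ := hy.2 h'
    have := ha m
    rw [Fintype.sum_subsingleton _ m] at *
    cases hxm : x m <;> simp [hm, hxm] at * <;> linarith
  · obtain ⟨m, hm, hgm⟩ := hy.1 h'
    have := ha m
    rw [Fintype.sum_subsingleton _ m] at *
    cases hxm : x m <;> simp [hm, hxm] at * <;> linarith

theorem level_le {a : α → ℝ} {x y : α → Bool} (h : 1 < Fintype.card α) :
    level a x y ≤ Fintype.card α - 1 := by
  have := (mismatch a x y).card_le_univ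
  unfold level
  omega

theorem inv_card_sq_nonneg : 0 ≤ 1 / (Fintype.card α : ℝ) ^ 2 := by positivity

theorem potential_nonneg (a : α → ℝ) (b : ℝ) (x y : α → Bool) : 0 ≤ potential a b x y := by
  unfold potential
  split_ifs
  · exact le_rfl
  · exact geo_nonneg inv_card_sq_nonneg _
  · exact geo_nonneg inv_card_sq_nonneg _

theorem potential_le {a : α → ℝ} {b : ℝ} {x : α → Bool} (ha : ∀ j, 0 ≤ a j)
    (hx : gap a b x = 0) (y : α → Bool) :
    potential a b x y ≤ geo (1 / (Fintype.card α : ℝ) ^ 2) (Fintype.card α - 1) := by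
  unfold potential
  split_ifs with h1 h2
  · exact geo_nonneg inv_card_sq_nonneg _
  · exact geo_mono inv_card_sq_nonneg (level_le (h2.one_lt_card ha hx h1))
  · exact le_rfl

theorem potential_of_stable {a : α → ℝ} {b : ℝ} {x y : α → Bool} (h : gap a b y ≠ 0)
    (hy : Stable a b y) :
    potential a b x y = geo (1 / (Fintype.card α : ℝ) ^ 2) (level a x y) := by
  simp [potential, h, hy]

theorem one_le_potential {a : α → ℝ} {b : ℝ} {x y : α → Bool} (h : gap a b y ≠ 0)
    (hy : Stable a b y) : 1 ≤ potential a b x y := by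
  rw [potential_of_stable h hy]
  exact one_le_geo inv_card_sq_nonneg (le_max_left _ _)

variable [DecidableEq α]

/-- Some randomization outcome lowers the level of a stable infeasible point. -/
theorem exists_potential_flip_le {a : α → ℝ} {b : ℝ} {x y : α → Bool} (ha : ∀ j, 0 ≤ a j)
    (hx : gap a b x = 0) (hy : Stable a b y) (h : gap a b y ≠ 0) :
    ∃ j l, a j ≠ 0 ∧ a l ≠ 0 ∧ potential a b x (flip y {j, l}) ≤
      geo (1 / (Fintype.card α : ℝ) ^ 2) (level a x y - 1) := by
  have hmem : ∀ j ∈ mismatch a x y, a j ≠ 0 := fun j hj => (mem_mismatch.1 hj).1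
  have hsolve : ∀ j l, mismatch a x y = {j, l} → potential a b x (flip y {j, l}) ≤
      geo (1 / (Fintype.card α : ℝ) ^ 2) (level a x y - 1) := by
    intro j l hjl
    have : gap a b (flip y {j, l}) = 0 := by
      refine gap_eq_zero_of_mismatch_eq_empty hx ?_
      rw [mismatch_flip a x y hjl.ge, hjl, Finset.sdiff_self]
    simpa [potential, this] using geo_nonneg inv_card_sq_nonneg _
  rcases Nat.lt_or_ge (mismatch a x y).card 3 with hc | hc
  · have h0 : (mismatch a x y).card ≠ 0 := fun h0 =>
      h (gap_eq_zero_of_mismatch_eq_empty hx (Finset.card_eq_zero.1 h0))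
    obtain h1 | h2 : (mismatch a x y).card = 1 ∨ (mismatch a x y).card = 2 := by omega
    · obtain ⟨j, hj⟩ := Finset.card_eq_one.1 h1
      have haj := hmem j (by simp [hj])
      exact ⟨j, j, haj, haj, hsolve j j (by simp [hj])⟩
    · obtain ⟨j, l, -, hjl⟩ := Finset.card_eq_two.1 h2
      exact ⟨j, l, hmem j (by simp [hjl]), hmem l (by simp [hjl]), hsolve j l hjl⟩
  · obtain ⟨j, hj, l, hl, hst⟩ : ∃ j ∈ mismatch a x y, ∃ l ∈ mismatch a x y,
        Stable a b (flip y {j, l}) := by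
      rcases lt_or_gt_of_ne h with h' | h'
      · exact exists_stable_flip_of_gap_neg ha hx hy h'
      · exact exists_stable_flip_of_gap_pos ha hx hy h'
    refine ⟨j, l, hmem j hj, hmem l hl, ?_⟩
    by_cases hg : gap a b (flip y {j, l}) = 0
    · simpa [potential, hg] using geo_nonneg inv_card_sq_nonneg _
    rw [potential_of_stable hg hst]
    refine geo_mono inv_card_sq_nonneg ?_
    have hlt : (mismatch a x (flip y {j, l})).card < (mismatch a x y).card := by
      rw [mismatch_flip a x y (by simp [Finset.insert_subset_iff, hj, hl])]
      exact Finset.card_lt_card (Finset.sdiff_ssubset (by simp [Finset.insert_subset_iff, hj, hl])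
        ⟨j, by simp⟩)
    unfold level
    omega

end Potential

/-! ### Projections, vertices and certificates -/

section Relaxation

variable {k : ℕ} {n : Fin k → ℕ} {a : (i : Fin k) → Fin (n i) → ℝ} {b : Fin k → ℝ}

/-- The part of a 0/1 point that belongs to block `i`. -/
def block (z : (Σ i : Fin k, Fin (n i)) → Bool) (i : Fin k) : Fin (n i) → Bool :=
  fun j => z ⟨i, j⟩

theorem toVec_block (z : (Σ i : Fin k, Fin (n i)) → Bool) (i : Fin k) (j : Fin (n i)) :
    toVec (block z i) j = toVec z ⟨i, j⟩ := rfl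

theorem subsetSumMatrix_mulVec (x : (Σ i : Fin k, Fin (n i)) → ℝ) (r : Fin k × Bool) :
    (subsetSumMatrix a *ᵥ x) r =
      if r.2 then ∑ j, a r.1 j * x ⟨r.1, j⟩ else -∑ j, a r.1 j * x ⟨r.1, j⟩ := by
  obtain ⟨i, s⟩ := r
  simp only [Matrix.mulVec, dotProduct, Fintype.sum_sigma, subsetSumMatrix]
  rw [Finset.sum_eq_single i (fun i' _ h => by simp [h]) (by simp)]
  cases s <;> simp

theorem mem_relaxation_iff {x : (Σ i : Fin k, Fin (n i)) → ℝ} :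
    x ∈ relaxation (subsetSumMatrix a) (subsetSumRhs b) ↔
      (∀ v, x v ∈ Set.Icc (0 : ℝ) 1) ∧ ∀ i, ∑ j, a i j * x ⟨i, j⟩ = b i := by
  simp only [relaxation, Set.mem_ofPred_eq, Pi.le_def, subsetSumMatrix_mulVec, subsetSumRhs]
  refine and_congr_right fun _ => ⟨fun h i => ?_, fun h r => ?_⟩
  · have h1 := h (i, true)
    have h2 := h (i, false)
    simp at h1 h2
    linarith
  · obtain ⟨i, s⟩ := r
    cases s <;> simp [h i]

theorem toVec_mem_relaxation_iff {z : (Σ i : Fin k, Fin (n i)) → Bool} :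
    toVec z ∈ relaxation (subsetSumMatrix a) (subsetSumRhs b) ↔
      ∀ i, gap (a i) (b i) (block z i) = 0 := by
  rw [mem_relaxation_iff]
  have : ∀ v, toVec z v ∈ Set.Icc (0 : ℝ) 1 := fun v => by
    unfold toVec; split_ifs <;> simp
  simp only [this, implies_true, true_and, gap, toVec_block, sub_eq_zero]
  exact forall_congr' fun i => eq_comm

theorem mem_subsetSumSet_iff {z : (Σ i : Fin k, Fin (n i)) → Bool} :
    z ∈ subsetSumSet a b ↔ ∀ i, gap (a i) (b i) (block z i) = 0 := by
  simp only [subsetSumSet, Set.mem_ofPred_eq, gap, toVec_block, sub_eq_zero]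
  exact forall_congr' fun i => eq_comm

/-- A vertex has at most one fractional coordinate with a nonzero coefficient in each block:
along two of them one could move in both directions. -/
theorem eq_of_fractional_of_mem_extremePoints (ha : ∀ i j, 0 ≤ a i j)
    {x : (Σ i : Fin k, Fin (n i)) → ℝ}
    (hx : x ∈ (relaxation (subsetSumMatrix a) (subsetSumRhs b)).extremePoints ℝ) {i : Fin k}
    {f h : Fin (n i)} (haf : a i f ≠ 0) (hah : a i h ≠ 0)
    (hf : x ⟨i, f⟩ ∈ Set.Ioo (0 : ℝ) 1) (hh : x ⟨i, h⟩ ∈ Set.Ioo (0 : ℝ) 1) : f = h := by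
  by_contra hne
  have haf' : 0 < a i f := lt_of_le_of_ne (ha i f) haf.symm
  have hah' : 0 < a i h := lt_of_le_of_ne (ha i h) hah.symm
  obtain ⟨hxP, hext⟩ := hx
  obtain ⟨hx01, hxb⟩ := mem_relaxation_iff.1 hxP
  obtain ⟨ε, hε, h1, h2, h3, h4⟩ : ∃ ε > 0, ε * a i h ≤ x ⟨i, f⟩ ∧ ε * a i h ≤ 1 - x ⟨i, f⟩ ∧
      ε * a i f ≤ x ⟨i, h⟩ ∧ ε * a i f ≤ 1 - x ⟨i, h⟩ := by
    have hfp := hf.1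
    have hf1 := sub_pos.2 hf.2
    have hhp := hh.1
    have hh1 := sub_pos.2 hh.2
    refine ⟨min (min (x ⟨i, f⟩ / a i h) ((1 - x ⟨i, f⟩) / a i h))
      (min (x ⟨i, h⟩ / a i f) ((1 - x ⟨i, h⟩) / a i f)), by positivity, ?_, ?_, ?_, ?_⟩
    · rw [← le_div_iff₀ hah']; simp
    · rw [← le_div_iff₀ hah']; simp
    · rw [← le_div_iff₀ haf']; simp
    · rw [← le_div_iff₀ haf']; simp
  have hv : (⟨i, f⟩ : Σ i : Fin k, Fin (n i)) ≠ ⟨i, h⟩ := by simpa using hne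
  -- the direction preserves the equation of block `i`
  set d : (Σ i : Fin k, Fin (n i)) → ℝ :=
    Pi.single ⟨i, f⟩ (ε * a i h) - Pi.single ⟨i, h⟩ (ε * a i f) with hd
  have hdf : d ⟨i, f⟩ = ε * a i h := by simp [hd, Pi.single_eq_of_ne hv]
  have hdh : d ⟨i, h⟩ = -(ε * a i f) := by simp [hd, Pi.single_eq_of_ne hv.symm]
  have hdo : ∀ v, v ≠ ⟨i, f⟩ → v ≠ ⟨i, h⟩ → d v = 0 := fun v h1 h2 => by
    simp [hd, Pi.single_eq_of_ne h1, Pi.single_eq_of_ne h2]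
  have hsum : ∀ i', ∑ j, a i' j * d ⟨i', j⟩ = 0 := by
    intro i'
    by_cases hi : i' = i
    · subst hi
      rw [← Finset.sum_subset (Finset.subset_univ {f, h}) fun j _ hj => ?_,
        Finset.sum_pair hne, hdf, hdh]
      · ring
      · simp only [Finset.mem_insert, Finset.mem_singleton, not_or] at hj
        rw [hdo _ (by simpa using hj.1) (by simpa using hj.2), mul_zero]
    · refine Finset.sum_eq_zero fun j _ => ?_
      rw [hdo _ (fun h => hi (congrArg Sigma.fst h)) (fun h => hi (congrArg Sigma.fst h)),
        mul_zero]
  have hmem : ∀ s : ℝ, s = 1 ∨ s = -1 →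
      x + s • d ∈ relaxation (subsetSumMatrix a) (subsetSumRhs b) := by
    intro s hs
    refine mem_relaxation_iff.2 ⟨fun v => ?_, fun i' => ?_⟩
    · have := hx01 v
      have p1 := mul_pos hε haf'
      have p2 := mul_pos hε hah'
      simp only [Pi.add_apply, Pi.smul_apply, smul_eq_mul, Set.mem_Icc] at *
      by_cases hvf : v = ⟨i, f⟩
      · subst hvf
        rw [hdf]
        rcases hs with rfl | rfl <;> constructor <;> linarith
      by_cases hvh : v = ⟨i, h⟩
      · subst hvh
        rw [hdh]
        rcases hs with rfl | rfl <;> constructor <;> linarith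
      · rw [hdo v hvf hvh]
        simpa using this
    · have e : ∀ j, a i' j * (x + s • d) ⟨i', j⟩ =
          a i' j * x ⟨i', j⟩ + s * (a i' j * d ⟨i', j⟩) := fun j => by
        simp only [Pi.add_apply, Pi.smul_apply, smul_eq_mul]; ring
      rw [Finset.sum_congr rfl fun j _ => e j, Finset.sum_add_distrib, ← Finset.mul_sum, hsum,
        hxb]
      simp
  have heq := hext (hmem 1 (.inl rfl)) (hmem (-1) (.inr rfl))
    ⟨1 / 2, 1 / 2, by norm_num, by norm_num, by norm_num, by
      ext v; simp only [Pi.add_apply, Pi.smul_apply, smul_eq_mul]; ring⟩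
  have := congrFun heq ⟨i, f⟩
  simp only [Pi.add_apply, Pi.smul_apply, smul_eq_mul, hdf] at this
  have := mul_pos hε hah'
  linarith

/-- Rounding a vertex gives a point all of whose blocks are stable: the only error that rounding
makes in a block comes from its single fractional coordinate. -/
theorem stable_roundVec_of_mem_extremePoints (ha : ∀ i j, 0 ≤ a i j)
    {x : (Σ i : Fin k, Fin (n i)) → ℝ}
    (hx : x ∈ (relaxation (subsetSumMatrix a) (subsetSumRhs b)).extremePoints ℝ) (i : Fin k) :
    Stable (a i) (b i) (block (roundVec x) i) := by
  obtain ⟨hx01, hxb⟩ := mem_relaxation_iff.1 hx.1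
  have hgap : gap (a i) (b i) (block (roundVec x) i) =
      ∑ j, a i j * (x ⟨i, j⟩ - toVec (roundVec x) ⟨i, j⟩) := by
    simp only [mul_sub, Finset.sum_sub_distrib, hxb, gap, toVec_block]
  have hint : ∀ v, x v ∉ Set.Ioo (0 : ℝ) 1 → x v - toVec (roundVec x) v = 0 := by
    intro v hv
    have h01 := hx01 v
    rcases eq_or_lt_of_le h01.1 with h | h
    · simp only [toVec, roundVec, ← h]; norm_num
    · have : x v = 1 := le_antisymm h01.2 (not_lt.1 fun h' => hv ⟨h, h'⟩)
      simp only [toVec, roundVec, this]; norm_num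
  by_cases hex : ∃ f, a i f ≠ 0 ∧ x ⟨i, f⟩ ∈ Set.Ioo (0 : ℝ) 1
  · obtain ⟨f, haf, hf⟩ := hex
    have hpos : 0 < a i f := lt_of_le_of_ne (ha i f) haf.symm
    rw [Finset.sum_eq_single f (fun j _ hj => ?_) (by simp)] at hgap
    · by_cases hhalf : 1 / 2 ≤ x ⟨i, f⟩
      · have hr : roundVec x ⟨i, f⟩ = true := by simp [roundVec]; linarith
        simp only [toVec, hr, if_true] at hgap
        have := mul_pos hpos (sub_pos.2 hf.2)
        have := mul_nonneg hpos.le (sub_nonneg.2 hhalf)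
        exact ⟨fun h => absurd h (by rw [hgap]; linarith),
          fun _ => ⟨f, hr, by rw [hgap]; linarith⟩⟩
      · have hr : roundVec x ⟨i, f⟩ = false := by simp [roundVec]; linarith
        push Not at hhalf
        simp only [toVec, hr, Bool.false_eq_true, if_false] at hgap
        have := mul_pos hpos hf.1
        have := mul_pos hpos (sub_pos.2 hhalf)
        exact ⟨fun _ => ⟨f, hr, by rw [hgap]; linarith⟩,
          fun h => absurd h (by rw [hgap]; linarith)⟩
    · by_cases haj : a i j = 0
      · simp [haj]
      · rw [hint _ fun hxj => hj (eq_of_fractional_of_mem_extremePoints ha hx haj haf hxj hf),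
          mul_zero]
  · push Not at hex
    refine Stable.of_gap_eq_zero (hgap.trans (Finset.sum_eq_zero fun j _ => ?_))
    by_cases haj : a i j = 0
    · simp [haj]
    · rw [hint _ (hex j haj), mul_zero]

/-- An `ℓ₁`-projection onto the relaxation is an `ℓ₁`-projection in each block. -/
theorem IsL1Proj.sum_block_le {z : (Σ i : Fin k, Fin (n i)) → Bool}
    {x : (Σ i : Fin k, Fin (n i)) → ℝ}
    (hx : IsL1Proj (relaxation (subsetSumMatrix a) (subsetSumRhs b)) z x) (i : Fin k)
    {y : Fin (n i) → ℝ} (hy01 : ∀ j, y j ∈ Set.Icc (0 : ℝ) 1) (hy : ∑ j, a i j * y j = b i) :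
    ∑ j, |toVec z ⟨i, j⟩ - x ⟨i, j⟩| ≤ ∑ j, |toVec z ⟨i, j⟩ - y j| := by
  obtain ⟨hx01, hxb⟩ := mem_relaxation_iff.1 hx.1
  set w : (i : Fin k) → Fin (n i) → ℝ := Function.update (fun i j => x ⟨i, j⟩) i y with hw
  have hwi : w i = y := by simp [hw]
  have hwo : ∀ i', i' ≠ i → w i' = fun j => x ⟨i', j⟩ := fun i' h => by simp [hw, h]
  have hmin := hx.2 (fun v => w v.1 v.2) (mem_relaxation_iff.2 ⟨fun v => ?_, fun i' => ?_⟩)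
  · simp only [Fintype.sum_sigma] at hmin
    rw [← Finset.add_sum_erase _ _ (Finset.mem_univ i),
      ← Finset.add_sum_erase _ _ (Finset.mem_univ i), hwi] at hmin
    have : ∑ i' ∈ Finset.univ.erase i, ∑ j, |toVec z ⟨i', j⟩ - w i' j| =
        ∑ i' ∈ Finset.univ.erase i, ∑ j, |toVec z ⟨i', j⟩ - x ⟨i', j⟩| :=
      Finset.sum_congr rfl fun i' hi' => by rw [hwo i' (Finset.ne_of_mem_erase hi')]
    linarith
  · obtain ⟨i', j⟩ := v
    by_cases h : i' = i
    · subst h; simpa [hwi] using hy01 j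
    · simpa [hwo i' h] using hx01 ⟨i', j⟩
  · by_cases h : i' = i
    · subst h; simpa [hwi] using hy
    · simpa [hwo i' h] using hxb i'

/-- Projecting and rounding does not change a stable block: the projection moves by at most `1/2`
in `ℓ₁`-norm, and by less if the point has to be increased. -/
theorem IsL1Proj.block_roundVec {z : (Σ i : Fin k, Fin (n i)) → Bool}
    {x : (Σ i : Fin k, Fin (n i)) → ℝ}
    (hx : IsL1Proj (relaxation (subsetSumMatrix a) (subsetSumRhs b)) z x) (ha : ∀ i j, 0 ≤ a i j)
    {i : Fin k} (hz : Stable (a i) (b i) (block z i)) :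
    block (roundVec x) i = block z i := by
  obtain ⟨hx01, hxb⟩ := mem_relaxation_iff.1 hx.1
  have hz01 : ∀ j, toVec z ⟨i, j⟩ ∈ Set.Icc (0 : ℝ) 1 := fun j => by
    unfold toVec; split_ifs <;> simp
  have hgap : gap (a i) (b i) (block z i) = b i - ∑ j, a i j * toVec z ⟨i, j⟩ := rfl
  -- repairing the equation by moving the single coordinate `m`
  have hrepair : ∀ m, a i m ≠ 0 →
      toVec z ⟨i, m⟩ + gap (a i) (b i) (block z i) / a i m ∈ Set.Icc (0 : ℝ) 1 →
      ∑ j, |toVec z ⟨i, j⟩ - x ⟨i, j⟩| ≤ |gap (a i) (b i) (block z i) / a i m| := by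
    intro m ham hm
    set t := gap (a i) (b i) (block z i) / a i m with ht
    refine (hx.sum_block_le i (y := fun j => toVec z ⟨i, j⟩ + (if j = m then t else 0))
      (fun j => ?_) ?_).trans_eq ?_
    · by_cases h : j = m
      · subst h; simpa using hm
      · simpa [h] using hz01 j
    · simp only [mul_add, Finset.sum_add_distrib, mul_ite, mul_zero, Finset.sum_ite_eq',
        Finset.mem_univ, if_true]
      rw [ht, mul_div_cancel₀ _ ham, hgap]
      ring
    · simp [apply_ite abs]
  have hle : ∀ j, |toVec z ⟨i, j⟩ - x ⟨i, j⟩| ≤ ∑ j, |toVec z ⟨i, j⟩ - x ⟨i, j⟩| := fun j =>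
    Finset.single_le_sum (f := fun j => |toVec z ⟨i, j⟩ - x ⟨i, j⟩|)
      (fun _ _ => abs_nonneg _) (Finset.mem_univ j)
  have hlt : (∑ j, |toVec z ⟨i, j⟩ - x ⟨i, j⟩|) < 1 / 2 →
      block (roundVec x) i = block z i := by
    intro h
    ext j
    have := abs_lt.1 ((hle j).trans_lt h)
    cases hzj : z ⟨i, j⟩ <;> simp [block, roundVec, toVec, hzj] at this ⊢ <;> linarith
  rcases lt_trichotomy (gap (a i) (b i) (block z i)) 0 with hg | hg | hg
  · obtain ⟨m, hm, hgm⟩ := hz.2 hg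
    have ham : 0 < a i m := by linarith
    have hzm : toVec z ⟨i, m⟩ = 1 := by simpa [toVec, block] using hm
    have hd1 : -(1 / 2) ≤ gap (a i) (b i) (block z i) / a i m := by
      rw [le_div_iff₀ ham]; linarith
    have hd2 : gap (a i) (b i) (block z i) / a i m ≤ 0 :=
      div_nonpos_of_nonpos_of_nonneg hg.le ham.le
    have hD := hrepair m ham.ne' ⟨by rw [hzm]; linarith, by rw [hzm]; linarith⟩
    rw [abs_of_nonpos hd2] at hD
    ext j
    have hj := abs_le.1 ((hle j).trans (hD.trans (by linarith : _ ≤ (1 / 2 : ℝ))))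
    cases hzj : z ⟨i, j⟩
    · simp only [block, roundVec, toVec, hzj] at hj ⊢
      simp only [Bool.false_eq_true, if_false] at hj
      -- a coordinate rising to `1/2` would use up the whole distance, although the sum has to drop
      have hne : x ⟨i, j⟩ ≠ 1 / 2 := by
        intro hxj
        have hz0 : toVec z ⟨i, j⟩ = 0 := by simp [toVec, hzj]
        have hrest : ∑ j' ∈ Finset.univ.erase j, |toVec z ⟨i, j'⟩ - x ⟨i, j'⟩| ≤ 0 := by
          have := Finset.add_sum_erase Finset.univ (fun j => |toVec z ⟨i, j⟩ - x ⟨i, j⟩|)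
            (Finset.mem_univ j)
          simp only [hz0, hxj] at this
          rw [zero_sub, abs_neg, abs_of_pos (by norm_num : (0 : ℝ) < 1 / 2)] at this
          linarith
        have hrest' : ∀ j', toVec z ⟨i, j'⟩ ≤ x ⟨i, j'⟩ := by
          intro j'
          by_cases hjj : j' = j
          · subst hjj; rw [hz0, hxj]; norm_num
          · have := (Finset.single_le_sum (f := fun j' => |toVec z ⟨i, j'⟩ - x ⟨i, j'⟩|)
              (fun _ _ => abs_nonneg _)
              (Finset.mem_erase.2 ⟨hjj, Finset.mem_univ j'⟩)).trans hrest
            have := (abs_le.1 this).2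
            linarith
        have := Finset.sum_le_sum fun j' (_ : j' ∈ Finset.univ) =>
          mul_le_mul_of_nonneg_left (hrest' j') (ha i j')
        rw [hxb] at this
        linarith
      have : x ⟨i, j⟩ < 1 / 2 := lt_of_le_of_ne (by linarith [hj.1]) hne
      simpa using this
    · simp [block, roundVec, toVec, hzj] at hj ⊢
      linarith
  · refine hlt ?_
    have := hx.sum_block_le i hz01 (by rw [hgap] at hg; linarith)
    simp only [sub_self, abs_zero, Finset.sum_const_zero] at this
    linarith
  · obtain ⟨m, hm, hgm⟩ := hz.1 hg
    have ham : 0 < a i m := by linarith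
    have hzm : toVec z ⟨i, m⟩ = 0 := by simpa [toVec, block] using hm
    have hd1 : gap (a i) (b i) (block z i) / a i m < 1 / 2 := by
      rw [div_lt_iff₀ ham]; linarith
    have hd2 : 0 < gap (a i) (b i) (block z i) / a i m := div_pos hg ham
    have hD := hrepair m ham.ne' ⟨by rw [hzm]; linarith, by rw [hzm]; linarith⟩
    rw [abs_of_pos hd2] at hD
    exact hlt (hD.trans_lt hd1)

/-- A minimal certificate consists of a single inequality, so its support is that of the equation
of a violated block. -/
theorem IsMinimalCertificate.exists_certSupport_eq {z : (Σ i : Fin k, Fin (n i)) → Bool}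
    {lam : Fin k × Bool → ℝ}
    (h : IsMinimalCertificate (subsetSumMatrix a) (subsetSumRhs b) z lam) :
    ∃ i, gap (a i) (b i) (block z i) ≠ 0 ∧ certSupport (subsetSumMatrix a) lam =
      (Finset.univ.filter fun j => a i j ≠ 0).map (Function.Embedding.sigmaMk i) := by
  obtain ⟨⟨hnn, hlt⟩, hmin⟩ := h
  -- one of the inequalities with positive multiplier is violated
  rw [← Matrix.dotProduct_mulVec, dotProduct, dotProduct] at hlt
  obtain ⟨r, -, hr⟩ := Finset.exists_lt_of_sum_lt hlt
  have hr0 : lam r ≠ 0 := by rintro h; simp [h] at hr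
  have hviol : subsetSumRhs b r < (subsetSumMatrix a *ᵥ toVec z) r :=
    lt_of_mul_lt_mul_left hr (hnn r)
  have hsupp := hmin (Pi.single r 1) ⟨fun r' => by
      by_cases h : r' = r
      · subst h; simp
      · simp [h], by
      rw [← Matrix.dotProduct_mulVec]; simpa using hviol⟩ (by
      intro r' hr'
      have : r' = r := by by_contra h; simp [h] at hr'
      subst this; exact hr0)
  have hlam : lam = Pi.single r (lam r) := by
    ext r'
    by_cases h : r' = r
    · subst h; simp
    · have : r' ∉ Function.support lam := by rw [← hsupp]; simp [h]
      simpa [h] using this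
  refine ⟨r.1, fun hg => ?_, ?_⟩
  · rw [subsetSumMatrix_mulVec, subsetSumRhs] at hviol
    have : b r.1 = ∑ j, a r.1 j * toVec z ⟨r.1, j⟩ := by
      simp only [gap, toVec_block] at hg; linarith
    rw [this] at hviol
    exact lt_irrefl _ hviol
  · ext ⟨i, j⟩
    rw [certSupport, hlam]
    obtain ⟨i', s⟩ := r
    by_cases hi : i = i'
    · subst hi
      cases s <;> simp [Matrix.single_vecMul, subsetSumMatrix, hr0]
    · cases s <;> simp [Matrix.single_vecMul, subsetSumMatrix, hi, Ne.symm hi]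

end Relaxation

/-! ### Expectations along a Markov chain -/

section Expectation

open scoped ENNReal

variable {σ τ : Type*}

/-- The expected value of an extended nonnegative function. -/
noncomputable def expect (p : PMF σ) (f : σ → ℝ≥0∞) : ℝ≥0∞ := ∑' s, p s * f s

theorem expect_pure (s : σ) (f : σ → ℝ≥0∞) : expect (PMF.pure s) f = f s := by
  unfold expect
  rw [tsum_eq_single s fun s' h => by simp [PMF.pure_apply, h]]
  simp

theorem expect_bind (p : PMF σ) (q : σ → PMF τ) (f : τ → ℝ≥0∞) :
    expect (p.bind q) f = expect p fun s => expect (q s) f := by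
  simp only [expect, PMF.bind_apply, ← ENNReal.tsum_mul_right, ← ENNReal.tsum_mul_left, mul_assoc]
  exact ENNReal.tsum_comm

theorem expect_map (p : PMF σ) (g : σ → τ) (f : τ → ℝ≥0∞) :
    expect (p.map g) f = expect p fun s => f (g s) := by
  simp only [PMF.map, expect_bind, Function.comp, expect_pure]

theorem expect_le_one (p : PMF σ) {f : σ → ℝ≥0∞} (hf : ∀ s, f s ≤ 1) : expect p f ≤ 1 := by
  calc expect p f ≤ ∑' s, p s * 1 := ENNReal.tsum_le_tsum fun s => mul_le_mul_right (hf s) _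
    _ = 1 := by simp [p.tsum_coe]

theorem expect_uniformOfFinset (t : Finset σ) (ht : t.Nonempty) (f : σ → ℝ≥0∞) :
    expect (PMF.uniformOfFinset t ht) f = (t.card : ℝ≥0∞)⁻¹ * ∑ s ∈ t, f s := by
  unfold expect
  rw [tsum_eq_sum (s := t) fun s hs => by simp [PMF.uniformOfFinset_apply, hs], Finset.mul_sum]
  exact Finset.sum_congr rfl fun s hs => by simp [PMF.uniformOfFinset_apply, hs]

theorem expect_uniformOfFinset_le {t : Finset σ} (ht : t.Nonempty) {f : σ → ℝ≥0∞} {G : σ → ℝ}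
    {C : ℝ} (hfG : ∀ s ∈ t, f s ≤ ENNReal.ofReal (G s)) (hG : ∀ s ∈ t, 0 ≤ G s)
    (hC : ∑ s ∈ t, G s ≤ t.card * C) :
    expect (PMF.uniformOfFinset t ht) f ≤ ENNReal.ofReal C := by
  have hcard : (0 : ℝ) < t.card := by exact_mod_cast ht.card_pos
  rw [expect_uniformOfFinset]
  calc (t.card : ℝ≥0∞)⁻¹ * ∑ s ∈ t, f s
      ≤ (t.card : ℝ≥0∞)⁻¹ * ENNReal.ofReal (t.card * C) := by
        refine mul_le_mul_right ((Finset.sum_le_sum hfG).trans ?_) _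
        rw [← ENNReal.ofReal_sum_of_nonneg hG]
        exact ENNReal.ofReal_le_ofReal hC
    _ = ENNReal.ofReal C := by
        rw [ENNReal.ofReal_mul hcard.le, ENNReal.ofReal_natCast, ← mul_assoc,
          ENNReal.inv_mul_cancel (by simpa using ht.ne_empty) (by simp), one_mul]

/-- The expected value of `f` after `t` transitions of the Markov chain with kernel `K`, as a
function of the starting state. -/
noncomputable def iterExpect (K : σ → PMF σ) (f : σ → ℝ≥0∞) : ℕ → σ → ℝ≥0∞
  | 0, s => f s
  | t + 1, s => expect (K s) (iterExpect K f t)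

theorem iterExpect_le_one (K : σ → PMF σ) {f : σ → ℝ≥0∞} (hf : ∀ s, f s ≤ 1) (t : ℕ) (s : σ) :
    iterExpect K f t s ≤ 1 := by
  induction t generalizing s with
  | zero => exact hf s
  | succ t ih => exact expect_le_one _ ih

theorem ofReal_one_sub_le_toOuterMeasure {p : PMF σ} {S : Set σ} {δ : ℝ} (hδ : 0 ≤ δ)
    (h : expect p (Sᶜ.indicator 1) ≤ ENNReal.ofReal δ) :
    ENNReal.ofReal (1 - δ) ≤ p.toOuterMeasure S := by
  have hsum : p.toOuterMeasure S + expect p (Sᶜ.indicator 1) = 1 := by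
    rw [PMF.toOuterMeasure_apply, expect, ← ENNReal.tsum_add, ← p.tsum_coe]
    refine tsum_congr fun s => ?_
    by_cases hs : s ∈ S <;> simp [hs]
  rw [ENNReal.ofReal_sub _ hδ, ENNReal.ofReal_one, tsub_le_iff_right, ← hsum]
  gcongr

end Expectation

/-! ### Runs of the algorithm -/

section Run

open scoped ENNReal

variable {ι κ : Type*} [Fintype ι] [DecidableEq ι] [Fintype κ] {A : Matrix κ ι ℝ} {b : κ → ℝ}
  {ℓ : ℕ} {proj : (ι → Bool) → (ι → ℝ)} {cert : (ι → Bool) → (κ → ℝ)}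

theorem expect_wfp (x₀ : ι → ℝ) (f : State ι → ℝ≥0∞) (t r : ℕ) :
    expect (wfp A b ℓ proj cert x₀ t) (iterExpect (step A b ℓ proj cert) f r) =
      iterExpect (step A b ℓ proj cert) f (t + r) (.running (roundVec x₀)) := by
  induction t generalizing r with
  | zero => simp [wfp, expect_pure]
  | succ t ih =>
    rw [wfp, expect_bind, show t + 1 + r = t + (r + 1) by omega, ← ih]
    rfl

theorem iterExpect_returned (f : State ι → ℝ≥0∞) (t : ℕ) (z : ι → Bool) :
    iterExpect (step A b ℓ proj cert) f t (.returned z) = f (.returned z) := by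
  induction t with
  | zero => rfl
  | succ t ih => rw [iterExpect, step, expect_pure, ih]

theorem iterExpect_succ_of_mem {z : ι → Bool} (h : toVec (roundVec (proj z)) ∈ relaxation A b)
    (f : State ι → ℝ≥0∞) (t : ℕ) :
    iterExpect (step A b ℓ proj cert) f (t + 1) (.running z) =
      f (.returned (roundVec (proj z))) := by
  rw [iterExpect, step, if_pos h, expect_pure, iterExpect_returned]

theorem iterExpect_succ_of_ne {z : ι → Bool} (h : toVec (roundVec (proj z)) ∉ relaxation A b)
    (hne : roundVec (proj z) ≠ z) (f : State ι → ℝ≥0∞) (t : ℕ) :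
    iterExpect (step A b ℓ proj cert) f (t + 1) (.running z) =
      iterExpect (step A b ℓ proj cert) f t (.running (roundVec (proj z))) := by
  rw [iterExpect, step, if_neg h, if_neg hne, expect_pure]

theorem iterExpect_succ_of_eq {z : ι → Bool} (h : toVec z ∉ relaxation A b)
    (heq : roundVec (proj z) = z) (f : State ι → ℝ≥0∞) (t : ℕ) :
    iterExpect (step A b ℓ proj cert) f (t + 1) (.running z) =
      expect (perturb A ℓ (cert z) z) fun w =>
        iterExpect (step A b ℓ proj cert) f t (.running w) := by
  rw [iterExpect, step, heq, if_neg h, if_pos rfl, expect_map]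

end Run

/-! ### The potential bounds the probability of failure -/

section SubsetSum

open scoped ENNReal

variable {k : ℕ} {n : Fin k → ℕ} {a : (i : Fin k) → Fin (n i) → ℝ} {b : Fin k → ℝ}

theorem block_flip_of_ne {i i' : Fin k} (h : i' ≠ i) (z : (Σ i : Fin k, Fin (n i)) → Bool)
    {I : Finset (Σ i : Fin k, Fin (n i))} (hI : ∀ v ∈ I, v.1 = i) :
    block (flip z I) i' = block z i' := by
  ext j
  have : (⟨i', j⟩ : Σ i : Fin k, Fin (n i)) ∉ I := fun hj => h (hI _ hj)
  simp [block, flip, this]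

theorem block_flip_pair (i : Fin k) (j l : Fin (n i)) (z : (Σ i : Fin k, Fin (n i)) → Bool) :
    block (flip z (Finset.univ.image ![⟨i, j⟩, ⟨i, l⟩])) i = flip (block z i) {j, l} := by
  ext j'
  have : (⟨i, j'⟩ : Σ i : Fin k, Fin (n i)) ∈ Finset.univ.image ![⟨i, j⟩, ⟨i, l⟩] ↔
      j' ∈ ({j, l} : Finset (Fin (n i))) := by
    simp [Fin.exists_fin_two, eq_comm]
  simp only [block, flip, this]

/-- The potential of a 0/1 point, given that block `i` may still use `m i` randomization steps:
the sum of the potentials of the blocks, discounted by the contraction still to come. It bounds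
the probability of failure. -/
noncomputable def totalPotential (a : (i : Fin k) → Fin (n i) → ℝ) (b : Fin k → ℝ)
    (x : (Σ i : Fin k, Fin (n i)) → Bool) (m : Fin k → ℕ)
    (z : (Σ i : Fin k, Fin (n i)) → Bool) : ℝ :=
  ∑ i, potential (a i) (b i) (block x i) (block z i) * contraction (n i) ^ m i

theorem totalPotential_nonneg (hn : ∀ i, 0 < n i) (x z : (Σ i : Fin k, Fin (n i)) → Bool)
    (m : Fin k → ℕ) : 0 ≤ totalPotential a b x m z :=
  Finset.sum_nonneg fun i _ =>
    mul_nonneg (potential_nonneg _ _ _ _) (pow_nonneg (contraction_nonneg (hn i)) _)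

/-- A randomization step charged to the violated block `i` keeps the expected potential below the
current one, if the budget of block `i` is lowered by one. -/
theorem sum_totalPotential_flip_le (hn : ∀ i, 0 < n i) (ha : ∀ i j, 0 ≤ a i j)
    {x z : (Σ i : Fin k, Fin (n i)) → Bool} (hx : ∀ i, gap (a i) (b i) (block x i) = 0)
    {i : Fin k} (hi : gap (a i) (b i) (block z i) ≠ 0) (hst : Stable (a i) (b i) (block z i))
    {m m' : Fin k → ℕ} (hmi : m i = m' i + 1) (hmo : ∀ i', i' ≠ i → m i' = m' i')
    {S : Finset (Σ i : Fin k, Fin (n i))}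
    (hS : S = (Finset.univ.filter fun j => a i j ≠ 0).map (Function.Embedding.sigmaMk i)) :
    ∑ f ∈ Fintype.piFinset fun _ : Fin 2 => S,
        totalPotential a b x m' (flip z (Finset.univ.image f)) ≤
      (Fintype.piFinset fun _ : Fin 2 => S).card * totalPotential a b x m z := by
  set t := Fintype.piFinset fun _ : Fin 2 => S with ht
  have hfst : ∀ f ∈ t, ∀ v ∈ Finset.univ.image f, v.1 = i := by
    intro f hf v hv
    obtain ⟨q, -, rfl⟩ := Finset.mem_image.1 hv
    have := Fintype.mem_piFinset.1 hf q
    rw [hS] at this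
    obtain ⟨j, -, hj⟩ := Finset.mem_map.1 this
    rw [← hj]; rfl
  have hone := hst.one_lt_card (ha i) (hx i) hi
  obtain ⟨j, l, hj, hl, hjl⟩ := exists_potential_flip_le (ha i) (hx i) hst hi
  have hlev := level_le (a := a i) (x := block x i) (y := block z i) hone
  have hpot := potential_of_stable (x := block x i) hi hst
  have hbound := potential_le (ha i) (hx i)
  simp only [Fintype.card_fin] at hone hjl hlev hpot hbound
  have hcard : t.card ≤ n i ^ 2 := by
    have : S.card ≤ n i := by
      rw [hS, Finset.card_map]
      simpa using Finset.card_le_univ (Finset.univ.filter fun j => a i j ≠ 0)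
    rw [ht, Fintype.card_piFinset_const]
    exact Nat.pow_le_pow_left this 2
  have hgood : ![⟨i, j⟩, ⟨i, l⟩] ∈ t := by
    rw [ht, Fintype.mem_piFinset, Fin.forall_fin_two, hS]
    simp [hj, hl]
  have hblock := sum_le_card_mul_contraction (t := t)
    (F := fun f => potential (a i) (b i) (block x i) (block (flip z (Finset.univ.image f)) i))
    (hn i) (le_max_left _ _) hlev hcard (fun f _ => hbound _) hgood
    (by rw [block_flip_pair]; exact hjl)
  change _ ≤ _ * (_ * geo _ (level (a i) (block x i) (block z i))) at hblock
  rw [← hpot] at hblock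
  unfold totalPotential
  rw [Finset.sum_comm, Finset.mul_sum]
  refine Finset.sum_le_sum fun i' _ => ?_
  rw [← Finset.sum_mul]
  by_cases h : i' = i
  · subst h
    rw [hmi, pow_succ', ← mul_assoc, ← mul_assoc]
    refine mul_le_mul_of_nonneg_right (hblock.trans_eq (by ring))
      (pow_nonneg (contraction_nonneg (hn i')) _)
  · rw [Finset.sum_congr rfl fun f hf => by rw [block_flip_of_ne h z (hfst f hf)],
      Finset.sum_const, nsmul_eq_mul, hmo i' h, mul_assoc]

/-- The probability that no solution has been returned after `t` iterations is at most the
potential, for any budgets `m i` of randomization steps: a randomization step costs at most two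
iterations, because the next point may have to be made stable first, and one more iteration returns
the solution. -/
theorem iterExpect_le_totalPotential (hn : ∀ i, 0 < n i) (ha : ∀ i j, 0 ≤ a i j)
    {x : (Σ i : Fin k, Fin (n i)) → Bool} (hx : ∀ i, gap (a i) (b i) (block x i) = 0)
    {proj : ((Σ i : Fin k, Fin (n i)) → Bool) → ((Σ i : Fin k, Fin (n i)) → ℝ)}
    (hproj : ∀ z, IsL1Proj (relaxation (subsetSumMatrix a) (subsetSumRhs b)) z (proj z))
    (hvertex : ∀ z, toVec z ∉ relaxation (subsetSumMatrix a) (subsetSumRhs b) →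
      proj z ∈ (relaxation (subsetSumMatrix a) (subsetSumRhs b)).extremePoints ℝ)
    {cert : ((Σ i : Fin k, Fin (n i)) → Bool) → (Fin k × Bool → ℝ)}
    (hcert : ∀ z, toVec z ∉ relaxation (subsetSumMatrix a) (subsetSumRhs b) →
      IsMinimalCertificate (subsetSumMatrix a) (subsetSumRhs b) z (cert z))
    {f : State (Σ i : Fin k, Fin (n i)) → ℝ≥0∞} (hf1 : ∀ s, f s ≤ 1)
    (hf0 : ∀ z ∈ subsetSumSet a b, f (.returned z) = 0)
    (t : ℕ) (z : (Σ i : Fin k, Fin (n i)) → Bool) (m : Fin k → ℕ)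
    (ht : 2 * ∑ i, m i + 2 ≤ t ∨
      2 * ∑ i, m i + 1 ≤ t ∧ ∀ i, Stable (a i) (b i) (block z i)) :
    iterExpect (step (subsetSumMatrix a) (subsetSumRhs b) 2 proj cert) f t (.running z) ≤
      ENNReal.ofReal (totalPotential a b x m z) := by
  induction t generalizing z m with
  | zero => omega
  | succ t ih =>
    have hkeep : ∀ i, Stable (a i) (b i) (block z i) →
        block (roundVec (proj z)) i = block z i := fun i h => (hproj z).block_roundVec ha h
    by_cases hmem : toVec (roundVec (proj z)) ∈ relaxation (subsetSumMatrix a) (subsetSumRhs b)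
    · rw [iterExpect_succ_of_mem hmem,
        hf0 _ (mem_subsetSumSet_iff.2 (toVec_mem_relaxation_iff.1 hmem))]
      exact zero_le
    have hz : toVec z ∉ relaxation (subsetSumMatrix a) (subsetSumRhs b) := by
      intro h
      refine hmem (toVec_mem_relaxation_iff.2 fun i => ?_)
      have := toVec_mem_relaxation_iff.1 h i
      rwa [hkeep i (.of_gap_eq_zero this)]
    have hstable := stable_roundVec_of_mem_extremePoints ha (hvertex z hz)
    by_cases heq : roundVec (proj z) = z
    · rw [heq] at hstable
      rw [iterExpect_succ_of_eq hz heq]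
      obtain ⟨i, hi, hS⟩ := (hcert z hz).exists_certSupport_eq
      obtain hmi | ⟨q, hq⟩ : m i = 0 ∨ ∃ q, m i = q + 1 := by
        cases h : m i
        · exact .inl rfl
        · exact .inr ⟨_, rfl⟩
      · refine (expect_le_one _ fun w => iterExpect_le_one _ hf1 _ _).trans ?_
        rw [← ENNReal.ofReal_one]
        refine ENNReal.ofReal_le_ofReal
          ((one_le_potential (x := block x i) hi (hstable i)).trans ?_)
        have := Finset.single_le_sum (f := fun i =>
          potential (a i) (b i) (block x i) (block z i) * contraction (n i) ^ m i)
          (fun i _ => mul_nonneg (potential_nonneg _ _ _ _)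
            (pow_nonneg (contraction_nonneg (hn i)) _)) (Finset.mem_univ i)
        simpa [totalPotential, hmi] using this
      · have hne : (certSupport (subsetSumMatrix a) (cert z)).Nonempty := by
          obtain ⟨j, -, hj, -⟩ := exists_potential_flip_le (ha i) (hx i) (hstable i) hi
          exact ⟨⟨i, j⟩, by rw [hS]; simp [hj]⟩
        set m' := Function.update m i q with hm'
        have hsum : ∑ i, m i = ∑ i, m' i + 1 := by
          rw [← Finset.add_sum_erase _ _ (Finset.mem_univ i),
            ← Finset.add_sum_erase _ m' (Finset.mem_univ i), hq,
            Finset.sum_congr rfl fun i' (hi' : i' ∈ Finset.univ.erase i) =>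
              show m i' = m' i' by simp [hm', Finset.ne_of_mem_erase hi']]
          simp only [hm', Function.update_self]
          ring
        rw [perturb, dif_pos hne, expect_map]
        refine expect_uniformOfFinset_le _ (fun g _ => ih _ m' (.inl (by omega)))
          (fun g _ => totalPotential_nonneg hn _ _ _)
          (sum_totalPotential_flip_le hn ha hx hi (hstable i) (by simp [hm', hq])
            (fun i' h => by simp [hm', h]) hS)
    · -- the point is not stable, so an iteration is available for making it stable
      rw [iterExpect_succ_of_ne hmem heq]
      have ht' : 2 * ∑ i, m i + 2 ≤ t + 1 := by
        refine ht.resolve_right fun h => heq ?_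
        ext ⟨i, j⟩
        exact congrFun (hkeep i (h.2 i)) j
      refine (ih _ m (.inr ⟨by omega, hstable⟩)).trans (ENNReal.ofReal_le_ofReal ?_)
      refine Finset.sum_le_sum fun i _ => mul_le_mul_of_nonneg_right ?_
        (pow_nonneg (contraction_nonneg (hn i)) _)
      by_cases h : Stable (a i) (b i) (block z i)
      · rw [hkeep i h]
      · have h0 : gap (a i) (b i) (block z i) ≠ 0 := fun h0 => h (.of_gap_eq_zero h0)
        conv_rhs => rw [potential, if_neg h0, if_neg h]
        exact potential_le (ha i) (hx i) _

end SubsetSum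

/-! ### Numerical estimates -/

section Numerics

theorem geo_mul_contraction_pow_le {N L : ℕ} (hN : 2 ≤ N) (hL : 1 ≤ L) :
    geo (1 / (N : ℝ) ^ 2) (N - 1) * contraction N ^ (3 * L * N ^ (2 * (N - 1))) ≤
      Real.exp (-L) := by
  have hN' : (2 : ℝ) ≤ N := by exact_mod_cast hN
  have hL' : (1 : ℝ) ≤ L := by exact_mod_cast hL
  obtain ⟨hp0, -⟩ := one_div_sq_mem (show 0 < N by omega)
  have hp : 1 / (N : ℝ) ^ 2 ≤ 1 / 4 := by
    apply one_div_le_one_div_of_le (by norm_num); nlinarith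
  have hM : ((N ^ (2 * (N - 1)) : ℕ) : ℝ) * (1 / (N : ℝ) ^ 2) ^ (N - 1) = 1 := by
    rw [Nat.cast_pow, pow_mul, ← mul_pow, mul_one_div_cancel (by positivity), one_pow]
  have hgeo := geo_mul (1 / (N : ℝ) ^ 2) (N - 1)
  have hc0 := contraction_nonneg (show 0 < N by omega)
  unfold contraction at *
  set p := 1 / (N : ℝ) ^ 2
  set M := N ^ (2 * (N - 1))
  have hg0 := geo_nonneg hp0.le (N - 1)
  have hpm : 0 < p ^ (N - 1) := by positivity
  have h1 : geo p (N - 1) ≤ Real.exp (1 / 3) := by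
    have := Real.add_one_le_exp (1 / 3 : ℝ)
    nlinarith
  have h2 : (1 - p ^ (N - 1) * (1 - p)) ^ (3 * L * M) ≤ Real.exp (-(9 / 4 * L)) := by
    calc (1 - p ^ (N - 1) * (1 - p)) ^ (3 * L * M)
        ≤ Real.exp (-(p ^ (N - 1) * (1 - p))) ^ (3 * L * M) :=
          pow_le_pow_left₀ hc0 (Real.one_sub_le_exp_neg _) _
      _ = Real.exp (-(3 * L * (1 - p))) := by
          rw [← Real.exp_nat_mul]
          congr 1
          push_cast
          linear_combination (-(3 * L * (1 - p)) : ℝ) * hM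
      _ ≤ _ := Real.exp_le_exp.2 (by nlinarith)
  calc _ ≤ Real.exp (1 / 3) * Real.exp (-(9 / 4 * L)) :=
        mul_le_mul h1 h2 (pow_nonneg hc0 _) (Real.exp_pos _).le
    _ = Real.exp (1 / 3 + -(9 / 4 * L)) := (Real.exp_add _ _).symm
    _ ≤ _ := Real.exp_le_exp.2 (by linarith)

theorem two_rpow_logb_eq {N : ℕ} (hN : 0 < N) :
    (2 : ℝ) ^ (2 * (N : ℝ) * Real.logb 2 N) = ((N ^ (2 * N) : ℕ) : ℝ) := by
  have : (0 : ℝ) < N := by exact_mod_cast hN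
  rw [mul_comm, Real.rpow_mul (by norm_num), Real.rpow_logb (by norm_num) (by norm_num) this]
  exact_mod_cast Real.rpow_natCast (N : ℝ) (2 * N)

end Numerics

/-! ### Budgets of randomization steps -/

section Budget

/-- The budget of randomization steps for a block of size `N`. It is zero for `N ≤ 1`, since a
stable block with a single variable is solved. -/
def budget (L N : ℕ) : ℕ := if 2 ≤ N then 3 * L * N ^ (2 * (N - 1)) else 0

/-- Two iterations for each budgeted randomization step, and two spare ones in a block of size at
least two, fit into the share `L * N * N ^ (2 * N)` of a block. -/
theorem two_mul_budget_le {L N : ℕ} (hL : 1 ≤ L) :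
    2 * budget L N + (if 2 ≤ N then 2 else 0) ≤ L * (N * N ^ (2 * N)) := by
  unfold budget
  split_ifs with hN
  · obtain ⟨q, rfl⟩ : ∃ q, N = q + 1 := ⟨N - 1, by omega⟩
    have hpow : (q + 1) * (q + 1) ^ (2 * (q + 1)) = (q + 1) ^ (2 * q) * (q + 1) ^ 3 := by ring
    have h8 : 2 ^ 3 ≤ (q + 1) ^ 3 := Nat.pow_le_pow_left hN 3
    have h1 : 1 ≤ L * (q + 1) ^ (2 * q) := Nat.mul_pos hL (by positivity)
    rw [hpow, Nat.add_sub_cancel]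
    generalize (q + 1) ^ (2 * q) = X at *
    calc 2 * (3 * L * X) + 2 ≤ L * X * 2 ^ 3 := by linarith
      _ ≤ L * X * (q + 1) ^ 3 := Nat.mul_le_mul_left _ h8
      _ = _ := by ring
  · simp

theorem two_mul_sum_budget_le {k L : ℕ} (n : Fin k → ℕ) (hL : 1 ≤ L)
    (h : ∃ i, 2 ≤ n i) :
    2 * ∑ i, budget L (n i) + 2 ≤ L * ∑ i, n i * n i ^ (2 * n i) := by
  obtain ⟨i, hi⟩ := h
  have h1 := Finset.sum_le_sum fun i (_ : i ∈ Finset.univ) => two_mul_budget_le (N := n i) hL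
  rw [Finset.sum_add_distrib, ← Finset.mul_sum, ← Finset.mul_sum] at h1
  have h2 := Finset.single_le_sum (f := fun i => if 2 ≤ n i then 2 else 0)
    (fun _ _ => Nat.zero_le _) (Finset.mem_univ i)
  simp only [hi, if_true] at h2
  omega

/-- With these budgets each block contributes at most `exp (-L)` to the failure probability. -/
theorem totalPotential_budget_le {k : ℕ} {n : Fin k → ℕ} {a : (i : Fin k) → Fin (n i) → ℝ}
    {b : Fin k → ℝ} (hn : ∀ i, 0 < n i) (ha : ∀ i j, 0 ≤ a i j)
    {x : (Σ i : Fin k, Fin (n i)) → Bool} (hx : ∀ i, gap (a i) (b i) (block x i) = 0)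
    {L : ℕ} (hL : 1 ≤ L) (z : (Σ i : Fin k, Fin (n i)) → Bool) :
    totalPotential a b x (fun i => budget L (n i)) z ≤ k * Real.exp (-L) := by
  have : ∀ i, potential (a i) (b i) (block x i) (block z i) *
      contraction (n i) ^ budget L (n i) ≤ Real.exp (-L) := by
    intro i
    have hp := potential_le (ha i) (hx i) (block z i)
    rw [Fintype.card_fin] at hp
    refine (mul_le_mul_of_nonneg_right hp (pow_nonneg (contraction_nonneg (hn i)) _)).trans ?_
    unfold budget
    split_ifs with h
    · exact geo_mul_contraction_pow_le h hL
    · have : n i - 1 = 0 := by omega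
      simp only [this, geo, Finset.range_zero, Finset.sum_empty, zero_mul]
      exact (Real.exp_pos _).le
  unfold totalPotential
  refine (Finset.sum_le_sum fun i _ => this i).trans_eq ?_
  simp

end Budget

end FeasibilityPump

open FeasibilityPump

theorem theorem2 {k : ℕ} (hk : 0 < k) (n : Fin k → ℕ) (hn : ∀ i, 0 < n i)
    (a : (i : Fin k) → Fin (n i) → ℝ) (b : Fin k → ℝ)
    (ha : ∀ i j, 0 ≤ a i j) (hb : ∀ i, 0 ≤ b i)
    (hfeas : (FeasibilityPump.subsetSumSet a b).Nonempty)
    (P : Set ((Σ i : Fin k, Fin (n i)) → ℝ))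
    (hP : P = FeasibilityPump.relaxation
      (FeasibilityPump.subsetSumMatrix a) (FeasibilityPump.subsetSumRhs b))
    -- the starting point: an optimal solution of the LP relaxation, for any linear objective
    (c x₀ : (Σ i : Fin k, Fin (n i)) → ℝ) (hx₀ : x₀ ∈ P)
    (hopt : ∀ x ∈ P, ∑ v, c v * x₀ v ≤ ∑ v, c v * x v)
    -- the projection: any choice of nearest points, which are vertices for points outside `P`
    (proj : ((Σ i : Fin k, Fin (n i)) → Bool) → ((Σ i : Fin k, Fin (n i)) → ℝ))
    (hproj : ∀ z, FeasibilityPump.IsL1Proj P z (proj z))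
    (hvertex : ∀ z, FeasibilityPump.toVec z ∉ P → proj z ∈ P.extremePoints ℝ)
    -- the certificates: any choice of minimal ones
    (cert : ((Σ i : Fin k, Fin (n i)) → Bool) → (Fin k × Bool → ℝ))
    (hcert : ∀ z, FeasibilityPump.toVec z ∉ P → FeasibilityPump.IsMinimalCertificate
      (FeasibilityPump.subsetSumMatrix a) (FeasibilityPump.subsetSumRhs b) z (cert z))
    (δ : ℝ) (hδ0 : 0 < δ) (hδ1 : δ ≤ 1)
    (T : ℝ)
    (hT : T = (⌈Real.log (k / δ)⌉ : ℝ) *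
      ∑ i, (n i : ℝ) * (2 : ℝ) ^ (2 * (n i : ℝ) * Real.logb 2 (n i)))
    (nbar : ℕ) (hnbar : nbar = Finset.univ.sup n) :
    ENNReal.ofReal (1 - δ) ≤
        (FeasibilityPump.wfp (FeasibilityPump.subsetSumMatrix a) (FeasibilityPump.subsetSumRhs b)
          2 proj cert x₀ ⌊T⌋₊).toOuterMeasure
          {s | ∃ z ∈ FeasibilityPump.subsetSumSet a b, s = FeasibilityPump.State.returned z} ∧
      T ≤ (nbar : ℝ) * k * (2 : ℝ) ^ (2 * (nbar : ℝ) * Real.logb 2 nbar) *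
        (⌈Real.log (k / δ)⌉ : ℝ) := by
  subst hP hnbar
  obtain ⟨x, hxS⟩ := hfeas
  have hx := mem_subsetSumSet_iff.1 hxS
  have hk1 : (1 : ℝ) ≤ k := by exact_mod_cast hk
  have hkδ : 0 < (k : ℝ) / δ := by positivity
  have hlog : 0 ≤ Real.log (k / δ) :=
    Real.log_nonneg (by rw [le_div_iff₀ hδ0]; linarith)
  obtain ⟨L, hL⟩ := Int.eq_ofNat_of_zero_le (Int.ceil_nonneg hlog)
  have hlogL : Real.log (k / δ) ≤ L := by
    have := Int.le_ceil (Real.log (k / δ))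
    rw [hL] at this
    exact_mod_cast this
  rw [hL, Int.cast_natCast] at hT ⊢
  have hTN : T = ((L * ∑ i, n i * n i ^ (2 * n i) : ℕ) : ℝ) := by
    rw [hT]
    push_cast
    congr 1
    refine Finset.sum_congr rfl fun i _ => ?_
    rw [two_rpow_logb_eq (hn i)]
    push_cast
    rfl
  constructor
  · rw [hTN, Nat.floor_natCast]
    refine ofReal_one_sub_le_toOuterMeasure hδ0.le ?_
    set f : State (Σ i : Fin k, Fin (n i)) → ENNReal :=
      {s | ∃ z ∈ subsetSumSet a b, s = State.returned z}ᶜ.indicator 1 with hf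
    have hf1 : ∀ s, f s ≤ 1 := fun s => Set.indicator_le_self _ _ s
    have hf0 : ∀ z ∈ subsetSumSet a b, f (.returned z) = 0 := fun z hz =>
      Set.indicator_of_notMem (by simpa using hz) _
    have hE := expect_wfp (A := subsetSumMatrix a) (b := subsetSumRhs b) (ℓ := 2) (proj := proj)
      (cert := cert) x₀ f (L * ∑ i, n i * n i ^ (2 * n i)) 0
    change expect _ f = _ at hE
    rw [hE, Nat.add_zero]
    rcases Nat.eq_zero_or_pos L with rfl | hLpos
    · -- zero iterations are allowed only if `k / δ ≤ 1`, that is, if nothing is claimed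
      have : (k : ℝ) / δ ≤ 1 := by
        by_contra! h
        have := Real.log_pos h
        simp at hlogL
        linarith
      rw [div_le_one hδ0] at this
      refine (iterExpect_le_one _ hf1 _ _).trans ?_
      rw [← ENNReal.ofReal_one]
      exact ENNReal.ofReal_le_ofReal (hk1.trans this)
    by_cases hbig : ∃ i, 2 ≤ n i
    · refine (iterExpect_le_totalPotential hn ha hx hproj hvertex hcert hf1 hf0 _ _ _
        (.inl (two_mul_sum_budget_le n hLpos hbig))).trans
        (ENNReal.ofReal_le_ofReal ((totalPotential_budget_le hn ha hx hLpos _).trans ?_))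
      have : Real.exp (-L) ≤ δ / k := by
        rw [← inv_div, ← Real.exp_log hkδ, ← Real.exp_neg]
        exact Real.exp_le_exp.2 (neg_le_neg hlogL)
      rwa [le_div_iff₀' (by linarith)] at this
    · -- with one variable in each block, the first rounded projection is a solution
      push Not at hbig
      obtain ⟨t, ht⟩ : ∃ t, L * ∑ i, n i * n i ^ (2 * n i) = t + 1 := by
        refine Nat.exists_eq_succ_of_ne_zero (Nat.mul_pos hLpos ?_).ne'
        exact Finset.sum_pos (fun i _ => Nat.mul_pos (hn i) (pow_pos (hn i) _))
          ⟨⟨0, hk⟩, Finset.mem_univ _⟩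
      have hround : toVec (roundVec (proj (roundVec x₀))) ∈
          relaxation (subsetSumMatrix a) (subsetSumRhs b) := by
        refine toVec_mem_relaxation_iff.2 fun i => ?_
        by_contra hne
        have hst : Stable (a i) (b i) (block (roundVec (proj (roundVec x₀))) i) := by
          by_cases hz : toVec (roundVec x₀) ∈ relaxation (subsetSumMatrix a) (subsetSumRhs b)
          · have := Stable.of_gap_eq_zero (toVec_mem_relaxation_iff.1 hz i)
            rwa [(hproj _).block_roundVec ha this]
          · exact stable_roundVec_of_mem_extremePoints ha (hvertex _ hz) i
        have := hst.one_lt_card (ha i) (hx i) hne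
        rw [Fintype.card_fin] at this
        exact absurd this (not_lt.2 (Nat.le_of_lt_succ (hbig i)))
      rw [ht, iterExpect_succ_of_mem hround,
        hf0 _ (mem_subsetSumSet_iff.2 (toVec_mem_relaxation_iff.1 hround))]
      exact zero_le
  · have hbar : 0 < Finset.univ.sup n :=
      (hn ⟨0, hk⟩).trans_le (Finset.le_sup (f := n) (Finset.mem_univ _))
    rw [hTN, two_rpow_logb_eq hbar]
    have : ∑ i, n i * n i ^ (2 * n i) ≤
        k * (Finset.univ.sup n * Finset.univ.sup n ^ (2 * Finset.univ.sup n)) := by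
      refine (Finset.sum_le_card_nsmul _ _
        (Finset.univ.sup n * Finset.univ.sup n ^ (2 * Finset.univ.sup n)) fun i _ => ?_).trans_eq
        (by simp)
      have hi : n i ≤ Finset.univ.sup n := Finset.le_sup (Finset.mem_univ i)
      exact Nat.mul_le_mul hi ((Nat.pow_le_pow_left hi _).trans
        (Nat.pow_le_pow_right hbar (by omega)))
    have := Nat.mul_le_mul_left L this
    calc _ ≤ ((L * (k * (Finset.univ.sup n *
          Finset.univ.sup n ^ (2 * Finset.univ.sup n))) : ℕ) : ℝ) := by exact_mod_cast this
      _ = _ := by push_cast; ring
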